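/- Let $A$ be an associative ring with unit, let $\mathcal C$ be an $A$-coring (an $(A,A)$-bimodule with a coassociative $(A,A)$-bilinear coproduct $\mathcal C\to\mathcal C\otimes_A\mathcal C$ and an $(A,A)$-bilinear counit $\mathcal C\to A$), and let $\mathbf M^{\mathcal C}$ be the category of right $\mathcal C$-comodules. Let $P\in\mathbf M^{\mathcal C}$ have coaction $\varrho^P:P\to P\otimes_A\mathcal C$, and put $S=\mathrm{End}^{\mathcal C}(P)$ (comodule endomorphisms) and $T=\mathrm{End}_A(P)$ (right $A$-linear endomorphisms), both acting on $P$ from the left. Assume that $P$ is a Galois comodule, i.e. for every right $A$-module $K$ the canonical map $$\mathrm{Hom}_A(P,K)\otimes_S P\to K\otimes_A\mathcal C,\qquad g\otimes p\mapsto (g\otimes I_{\mathcal C})\,\varrho^P(p),$$ is an isomorphism. Then: 1. If ${}_SP$ is finitely generated, then ${}_A\mathcal C$ is finitely generated. 2. If ${}_SP$ is Mittag-Leffler, then ${}_A\mathcal C$ is Mittag-Leffler. 3. If ${}_SP$ is finitely presented, then ${}_A\mathcal C$ is finitely presented. 4. If ${}_SP$ is projective, then ${}_A\mathcal C$ is projective.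 5. If ${}_TP$ is finitely generated and ${}_SP$ is locally projective, then ${}_A\mathcal C$ is locally projective. 6. If ${}_SP$ is flat, then ${}_A\mathcal C$ is flat and $P$ is a generator in $\mathbf M^{\mathcal C}$. 7. If ${}_SP$ is faithfully flat, then ${}_A\mathcal C$ is flat and $P$ is a projective generator in $\mathbf M^{\mathcal C}$. Here a left module $M$ over a ring $R$ is *Mittag-Leffler* if for every family $(Q_i)_{i\in I}$ of right $R$-modules the canonical map $(\prod_i Q_i)\otimes_R M\to\prod_i(Q_i\otimes_R M)$ is injective. It is *locally projective* if for every surjective $R$-linear map $f:L\to N$, every $R$-linear map $g:M\to N$ and every finitely generated submodule $F\subseteq M$ there is an $R$-linear map $h:M\to L$ with $f\circ h|_F=g|_F$. A comodule $P$ is a *generator* in $\mathbf M^{\mathcal C}$ if the functor $\mathrm{Hom}^{\mathcal C}(P,-)$ is faithful, and *projective* if it has the lifting property with respect to epimorphisms of $\mathbf M^{\mathcal C}$. -/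

import Mathlib

open MulOpposite CategoryTheory

open scoped TensorProduct

universe u

/-! Right `A`-modules are modules over `Aᵐᵒᵖ`: the element `m a` is `op a • m`. -/

/-! ## Tensor products over a noncommutative ring -/

/-- The tensor product `M ⊗_A N` of a right `A`-module and a left `A`-module, as an abelian group:
the quotient of `M ⊗_ℤ N` by the relations `m a ⊗ n = m ⊗ a n`. -/
def BTensor (A M N : Type*) [Ring A] [AddCommGroup M] [Module Aᵐᵒᵖ M]
    [AddCommGroup N] [Module A N] : Type _ :=
  (M ⊗[ℤ] N) ⧸ AddSubgroup.closure
    {x : M ⊗[ℤ] N | ∃ (m : M) (a : A) (n : N), x = (op a • m) ⊗ₜ[ℤ] n - m ⊗ₜ[ℤ] (a • n)}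

namespace BTensor

section Basic

variable {A M N : Type*} [Ring A] [AddCommGroup M] [Module Aᵐᵒᵖ M] [AddCommGroup N] [Module A N]

noncomputable instance : AddCommGroup (BTensor A M N) :=
  inferInstanceAs (AddCommGroup ((M ⊗[ℤ] N) ⧸ AddSubgroup.closure
    {x : M ⊗[ℤ] N | ∃ (m : M) (a : A) (n : N), x = (op a • m) ⊗ₜ[ℤ] n - m ⊗ₜ[ℤ] (a • n)}))

variable (A) in
/-- The pure tensor `m ⊗ n` in `M ⊗_A N`. -/
def tmul (m : M) (n : N) : BTensor A M N :=
  QuotientAddGroup.mk (m ⊗ₜ[ℤ] n)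

theorem tmul_add (m : M) (n n' : N) : tmul A m (n + n') = tmul A m n + tmul A m n' :=
  (congrArg QuotientAddGroup.mk (TensorProduct.tmul_add m n n')).trans rfl

theorem add_tmul (m m' : M) (n : N) : tmul A (m + m') n = tmul A m n + tmul A m' n :=
  (congrArg QuotientAddGroup.mk (TensorProduct.add_tmul m m' n)).trans rfl

theorem op_smul_tmul (a : A) (m : M) (n : N) : tmul A (op a • m) n = tmul A m (a • n) := by
  refine QuotientAddGroup.eq_iff_sub_mem.2 (AddSubgroup.subset_closure ⟨m, a, n, rfl⟩)

variable (A M N) in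
/-- The biadditive map `(m, n) ↦ m ⊗ n`. -/
noncomputable def mk : M →+ N →+ BTensor A M N :=
  AddMonoidHom.mk' (fun m => AddMonoidHom.mk' (fun n => tmul A m n) (tmul_add m))
    (fun m m' => AddMonoidHom.ext fun n => add_tmul m m' n)

@[simp] theorem mk_apply (m : M) (n : N) : mk A M N m n = tmul A m n := rfl

/-- A balanced biadditive map `M × N → G` induces an additive map on `M ⊗_A N`. -/
noncomputable def lift {G : Type*} [AddCommGroup G] (f : M →+ N →+ G)
    (hf : ∀ (a : A) (m : M) (n : N), f (op a • m) n = f m (a • n)) : BTensor A M N →+ G :=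
  QuotientAddGroup.lift _
    (TensorProduct.liftAddHom f (fun r m n => by rw [map_zsmul, map_zsmul, AddMonoidHom.zsmul_apply]))
    (by
      rw [AddSubgroup.closure_le]
      rintro _ ⟨m, a, n, rfl⟩
      simp [AddMonoidHom.mem_ker, hf])

@[simp] theorem lift_tmul {G : Type*} [AddCommGroup G] (f : M →+ N →+ G)
    (hf : ∀ (a : A) (m : M) (n : N), f (op a • m) n = f m (a • n)) (m : M) (n : N) :
    lift f hf (tmul A m n) = f m n := rfl

theorem induction_on {p : BTensor A M N → Prop} (x : BTensor A M N)
    (tmul : ∀ m n, p (tmul A m n)) (add : ∀ x y, p x → p y → p (x + y)) : p x := by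
  obtain ⟨x, rfl⟩ := QuotientAddGroup.mk_surjective x
  induction x using TensorProduct.induction_on with
  | zero =>
    have h : BTensor.tmul A (0 : M) (0 : N) = QuotientAddGroup.mk 0 :=
      congrArg QuotientAddGroup.mk (TensorProduct.zero_tmul M (0 : N))
    exact h ▸ tmul 0 0
  | tmul m n => exact tmul m n
  | add x y hx hy => exact add _ _ hx hy

theorem addHom_ext {G : Type*} [AddCommGroup G] {f g : BTensor A M N →+ G}
    (h : ∀ m n, f (tmul A m n) = g (tmul A m n)) : f = g := by
  ext x
  induction x using induction_on with
  | tmul m n => exact h m n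
  | add x y hx hy => rw [map_add, map_add, hx, hy]

end Basic

section Map

variable {A M N M' N' M'' N'' : Type*} [Ring A]
  [AddCommGroup M] [Module Aᵐᵒᵖ M] [AddCommGroup N] [Module A N]
  [AddCommGroup M'] [Module Aᵐᵒᵖ M'] [AddCommGroup N'] [Module A N']
  [AddCommGroup M''] [Module Aᵐᵒᵖ M''] [AddCommGroup N''] [Module A N'']

/-- The map `f ⊗ g : M ⊗_A N → M' ⊗_A N'`. -/
noncomputable def map (f : M →ₗ[Aᵐᵒᵖ] M') (g : N →ₗ[A] N') : BTensor A M N →+ BTensor A M' N' :=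
  lift
    { toFun := fun m =>
        { toFun := fun n => tmul A (f m) (g n)
          map_zero' := by simpa using tmul_add (A := A) (f m) (0 : N') 0
          map_add' := fun n n' => by rw [map_add, tmul_add] }
      map_zero' := by
        ext n
        simpa using add_tmul (A := A) (0 : M') 0 (g n)
      map_add' := fun m m' => by
        ext n
        simp [add_tmul] }
    (fun a m n => by simp [op_smul_tmul])

@[simp] theorem map_tmul (f : M →ₗ[Aᵐᵒᵖ] M') (g : N →ₗ[A] N') (m : M) (n : N) :
    map f g (tmul A m n) = tmul A (f m) (g n) := rfl

theorem map_id : map (LinearMap.id : M →ₗ[Aᵐᵒᵖ] M) (LinearMap.id : N →ₗ[A] N) =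
    AddMonoidHom.id _ :=
  addHom_ext fun _ _ => rfl

theorem map_map (f' : M' →ₗ[Aᵐᵒᵖ] M'') (g' : N' →ₗ[A] N'') (f : M →ₗ[Aᵐᵒᵖ] M') (g : N →ₗ[A] N')
    (x : BTensor A M N) : map f' g' (map f g x) = map (f' ∘ₗ f) (g' ∘ₗ g) x :=
  DFunLike.congr_fun (f := (map f' g').comp (map f g)) (g := map (f' ∘ₗ f) (g' ∘ₗ g))
    (addHom_ext fun _ _ => rfl) x

theorem map_add_left (f f' : M →ₗ[Aᵐᵒᵖ] M') (g : N →ₗ[A] N') :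
    map (f + f') g = map f g + map f' g :=
  addHom_ext fun _ _ => add_tmul _ _ _

theorem map_add_right (f : M →ₗ[Aᵐᵒᵖ] M') (g g' : N →ₗ[A] N') :
    map f (g + g') = map f g + map f g' :=
  addHom_ext fun _ _ => tmul_add _ _ _

theorem map_zero_left (g : N →ₗ[A] N') : map (0 : M →ₗ[Aᵐᵒᵖ] M') g = 0 := by
  simpa using map_add_left (0 : M →ₗ[Aᵐᵒᵖ] M') 0 g

theorem map_zero_right (f : M →ₗ[Aᵐᵒᵖ] M') : map f (0 : N →ₗ[A] N') = 0 := by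
  simpa using map_add_right f (0 : N →ₗ[A] N') 0

end Map

section Bimodule

variable {A R B M N : Type*} [Ring A] [Ring R] [Ring B]
  [AddCommGroup M] [Module Aᵐᵒᵖ M] [AddCommGroup N] [Module A N]

/-- If `M` is an `(R, A)`-bimodule then `M ⊗_A N` is a left `R`-module. -/
noncomputable instance (priority := 100) leftModule [Module R M] [SMulCommClass R Aᵐᵒᵖ M] :
    Module R (BTensor A M N) where
  smul r x := map (Module.toModuleEnd Aᵐᵒᵖ (S := R) M r) LinearMap.id x
  one_smul x := by
    change map (Module.toModuleEnd Aᵐᵒᵖ (S := R) M 1) LinearMap.id x = x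
    rw [map_one]
    exact DFunLike.congr_fun map_id x
  mul_smul r s x := by
    change map (Module.toModuleEnd Aᵐᵒᵖ (S := R) M (r * s)) LinearMap.id x =
      map (Module.toModuleEnd Aᵐᵒᵖ (S := R) M r) LinearMap.id
        (map (Module.toModuleEnd Aᵐᵒᵖ (S := R) M s) LinearMap.id x)
    rw [map_map, map_mul]
    rfl
  smul_zero r := map_zero _
  smul_add r x y := map_add _ x y
  add_smul r s x := by
    change map (Module.toModuleEnd Aᵐᵒᵖ (S := R) M (r + s)) LinearMap.id x = _
    rw [map_add, map_add_left]
    rfl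
  zero_smul x := by
    change map (Module.toModuleEnd Aᵐᵒᵖ (S := R) M 0) LinearMap.id x = 0
    rw [map_zero, map_zero_left]
    rfl

theorem smul_tmul [Module R M] [SMulCommClass R Aᵐᵒᵖ M] (r : R) (m : M) (n : N) :
    r • tmul A m n = tmul A (r • m) n := rfl

/-- If `N` is an `(A, B)`-bimodule then `M ⊗_A N` is a right `B`-module. -/
noncomputable instance rightModule [Module Bᵐᵒᵖ N] [SMulCommClass A Bᵐᵒᵖ N] :
    Module Bᵐᵒᵖ (BTensor A M N) :=
  haveI : SMulCommClass Bᵐᵒᵖ A N := SMulCommClass.symm _ _ _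
  { smul := fun b x => map LinearMap.id (Module.toModuleEnd A (S := Bᵐᵒᵖ) N b) x
    one_smul := fun x => by
      change map LinearMap.id (Module.toModuleEnd A (S := Bᵐᵒᵖ) N 1) x = x
      rw [map_one]
      exact DFunLike.congr_fun map_id x
    mul_smul := fun r s x => by
      change map LinearMap.id (Module.toModuleEnd A (S := Bᵐᵒᵖ) N (r * s)) x =
        map LinearMap.id (Module.toModuleEnd A (S := Bᵐᵒᵖ) N r)
          (map LinearMap.id (Module.toModuleEnd A (S := Bᵐᵒᵖ) N s) x)
      rw [map_map, map_mul]
      rfl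
    smul_zero := fun r => map_zero _
    smul_add := fun r x y => map_add _ x y
    add_smul := fun r s x => by
      change map LinearMap.id (Module.toModuleEnd A (S := Bᵐᵒᵖ) N (r + s)) x = _
      rw [map_add, map_add_right]
      rfl
    zero_smul := fun x => by
      change map LinearMap.id (Module.toModuleEnd A (S := Bᵐᵒᵖ) N 0) x = 0
      rw [map_zero, map_zero_right]
      rfl }

theorem op_smul_tmul_right [Module Bᵐᵒᵖ N] [SMulCommClass A Bᵐᵒᵖ N] (b : Bᵐᵒᵖ) (m : M) (n : N) :
    b • tmul A m n = tmul A m (b • n) := rfl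

end Bimodule

section Canonical

variable {A M N : Type*} [Ring A] [AddCommGroup M] [Module Aᵐᵒᵖ M] [AddCommGroup N] [Module A N]

variable (A N) in
/-- The canonical map `A ⊗_A N → N`, `a ⊗ n ↦ a n`. -/
noncomputable def lid : BTensor A A N →+ N :=
  lift (smulAddHom A N) (fun a b n => by simp [mul_smul])

variable (A M) in
/-- The canonical map `M ⊗_A A → M`, `m ⊗ a ↦ m a`. -/
noncomputable def rid : BTensor A M A →+ M :=
  lift
    { toFun := fun m =>
        { toFun := fun a => op a • m
          map_zero' := by simp
          map_add' := fun a b => by simp [add_smul] }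
      map_zero' := by
        ext a
        simp
      map_add' := fun m m' => by
        ext a
        simp }
    (fun a m b => by simp [mul_smul])

@[simp] theorem lid_tmul (a : A) (n : N) : lid A N (tmul A a n) = a • n := rfl

@[simp] theorem rid_tmul (m : M) (a : A) : rid A M (tmul A m a) = op a • m := rfl

/-- The canonical map `(∏ Q_i) ⊗_A N → ∏ (Q_i ⊗_A N)`. -/
noncomputable def piMap (A N : Type*) [Ring A] [AddCommGroup N] [Module A N] {ι : Type*}
    (Q : ι → Type*) [∀ i, AddCommGroup (Q i)] [∀ i, Module Aᵐᵒᵖ (Q i)] :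
    BTensor A (∀ i, Q i) N →+ ∀ i, BTensor A (Q i) N :=
  AddMonoidHom.pi fun i => map (LinearMap.proj i) LinearMap.id

end Canonical

section Assoc

variable {A M X N : Type*} [Ring A] [AddCommGroup M] [Module Aᵐᵒᵖ M]
  [AddCommGroup X] [Module A X] [Module Aᵐᵒᵖ X] [SMulCommClass A Aᵐᵒᵖ X]
  [AddCommGroup N] [Module A N]

variable (A M X N) in
/-- The biadditive map `(y, n) ↦ m ⊗ (x ⊗ n)` for `y = m ⊗ x`. -/
noncomputable def assocAux : BTensor A M X →+ N →+ BTensor A M (BTensor A X N) :=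
  lift
    (AddMonoidHom.mk'
      (fun m => (AddMonoidHom.compHom (mk A M (BTensor A X N) m)).comp (mk A X N))
      (fun m m' => by
        ext x n
        exact add_tmul m m' (tmul A x n)))
    (fun a m x => by
      ext n
      exact op_smul_tmul a m (tmul A x n))

variable (A M X N) in
/-- The canonical map `(M ⊗_A X) ⊗_A N → M ⊗_A (X ⊗_A N)`, `(m ⊗ x) ⊗ n ↦ m ⊗ (x ⊗ n)`. -/
noncomputable def assoc : BTensor A (BTensor A M X) N →+ BTensor A M (BTensor A X N) :=
  lift (assocAux A M X N)
    (fun a y n => by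
      induction y using induction_on with
      | tmul m x => exact congrArg (tmul A m) (op_smul_tmul a x n)
      | add y z hy hz =>
        rw [smul_add, map_add, map_add, AddMonoidHom.add_apply, AddMonoidHom.add_apply, hy, hz])

@[simp] theorem assoc_tmul (m : M) (x : X) (n : N) :
    assoc A M X N (tmul A (tmul A m x) n) = tmul A m (tmul A x n) := rfl

end Assoc

end BTensor

/-! ## Properties of left modules over a noncommutative ring -/

section ModuleProperties

variable (R M : Type u) [Ring R] [AddCommGroup M] [Module R M]

/-- `M` is flat: `- ⊗_R M` preserves injectivity of maps of right `R`-modules. -/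
def IsFlatModule : Prop :=
  ∀ (X Y : Type u) [AddCommGroup X] [AddCommGroup Y] [Module Rᵐᵒᵖ X] [Module Rᵐᵒᵖ Y]
    (f : X →ₗ[Rᵐᵒᵖ] Y), Function.Injective f →
      Function.Injective (BTensor.map f (LinearMap.id : M →ₗ[R] M))

/-- `M` is faithfully flat: it is flat, and `X ⊗_R M = 0` implies `X = 0`. -/
def IsFaithfullyFlatModule : Prop :=
  IsFlatModule R M ∧
    ∀ (X : Type u) [AddCommGroup X] [Module Rᵐᵒᵖ X], Subsingleton (BTensor R X M) → Subsingleton X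

/-- `M` is Mittag-Leffler: for every family `Q_i` of right `R`-modules, the canonical map
`(∏ Q_i) ⊗_R M → ∏ (Q_i ⊗_R M)` is injective. -/
def IsMittagLefflerModule : Prop :=
  ∀ (ι : Type u) (Q : ι → Type u) [∀ i, AddCommGroup (Q i)] [∀ i, Module Rᵐᵒᵖ (Q i)],
    Function.Injective (BTensor.piMap R M Q)

/-- `M` is locally projective: for every epimorphism `f : L → N`, every `g : M → N` and every
finitely generated submodule `F` of `M` there is `h : M → L` with `f ∘ h = g` on `F`. -/
def IsLocallyProjectiveModule : Prop :=
  ∀ (L N : Type u) [AddCommGroup L] [AddCommGroup N] [Module R L] [Module R N]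
    (f : L →ₗ[R] N) (g : M →ₗ[R] N) (F : Submodule R M), Function.Surjective f → F.FG →
      ∃ h : M →ₗ[R] L, ∀ x ∈ F, f (h x) = g x

end ModuleProperties

/-! ## Corings and comodules -/

/-- Homomorphisms of `(A, A)`-bimodules. -/
structure BimodHom (A X Y : Type*) [Ring A] [AddCommGroup X] [Module A X] [Module Aᵐᵒᵖ X]
    [AddCommGroup Y] [Module A Y] [Module Aᵐᵒᵖ Y] where
  /-- the map, as a map of left modules -/
  left : X →ₗ[A] Y
  map_op_smul : ∀ (a : A) (x : X), left (op a • x) = op a • left x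

/-- A bimodule homomorphism as a map of right modules. -/
def BimodHom.right {A X Y : Type*} [Ring A] [AddCommGroup X] [Module A X] [Module Aᵐᵒᵖ X]
    [AddCommGroup Y] [Module A Y] [Module Aᵐᵒᵖ Y] (f : BimodHom A X Y) : X →ₗ[Aᵐᵒᵖ] Y where
  toFun := f.left
  map_add' := map_add f.left
  map_smul' a x := f.map_op_smul a.unop x

/-- The structure of an `A`-coring on an `(A, A)`-bimodule `C`. -/
class Coring (A C : Type*) [Ring A] [AddCommGroup C] [Module A C] [Module Aᵐᵒᵖ C]
    [SMulCommClass A Aᵐᵒᵖ C] where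
  /-- the coproduct -/
  comul : BimodHom A C (BTensor A C C)
  /-- the counit -/
  counit : BimodHom A C A
  coassoc : ∀ c : C, BTensor.assoc A C C C (BTensor.map comul.right LinearMap.id (comul.left c)) =
    BTensor.map LinearMap.id comul.left (comul.left c)
  counit_comul : ∀ c : C, BTensor.lid A C (BTensor.map counit.right LinearMap.id (comul.left c)) = c
  comul_counit : ∀ c : C, BTensor.rid A C (BTensor.map LinearMap.id counit.left (comul.left c)) = c

section Comodules

variable (A C : Type u) [Ring A] [AddCommGroup C] [Module A C] [Module Aᵐᵒᵖ C]
  [SMulCommClass A Aᵐᵒᵖ C] [Coring A C]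

/-- Right `C`-comodules. -/
structure Comod where
  /-- the underlying type -/
  carrier : Type u
  [addCommGroup : AddCommGroup carrier]
  [module : Module Aᵐᵒᵖ carrier]
  /-- the coaction `M → M ⊗_A C` -/
  coact : carrier →ₗ[Aᵐᵒᵖ] BTensor A carrier C
  coassoc : ∀ m : carrier,
    BTensor.assoc A carrier C C (BTensor.map coact LinearMap.id (coact m)) =
      BTensor.map LinearMap.id (Coring.comul (A := A) (C := C)).left (coact m)
  coact_counit : ∀ m : carrier,
    BTensor.rid A carrier
      (BTensor.map LinearMap.id (Coring.counit (A := A) (C := C)).left (coact m)) = m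

namespace Comod

variable {A C}

instance : CoeSort (Comod A C) (Type u) := ⟨Comod.carrier⟩

attribute [instance] Comod.addCommGroup Comod.module

/-- Comodule morphisms: right `A`-linear maps `f` with `ϱ^N ∘ f = (f ⊗ I_C) ∘ ϱ^M`. -/
@[ext] structure Hom (M N : Comod A C) where
  /-- the underlying right `A`-linear map -/
  hom : M →ₗ[Aᵐᵒᵖ] N
  comm : ∀ m : M, N.coact (hom m) = BTensor.map hom LinearMap.id (M.coact m)

/-- The category `M^C` of right `C`-comodules. -/
instance : Category (Comod A C) where
  Hom M N := Hom M N
  id M := ⟨LinearMap.id, fun m => (DFunLike.congr_fun BTensor.map_id (M.coact m)).symm⟩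
  comp f g := ⟨g.hom ∘ₗ f.hom, fun m => by
    rw [LinearMap.comp_apply, g.comm, f.comm, BTensor.map_map]
    rfl⟩

/-- The ring `S = End^C(P)`, as a subring of `T = End_A(P)`; the product is composition and `P` is
a left module over both rings by evaluation. -/
def endRing (P : Comod A C) : Subring (Module.End Aᵐᵒᵖ P) where
  carrier := {f | ∀ p : P, P.coact (f p) = BTensor.map f LinearMap.id (P.coact p)}
  one_mem' := fun p => (DFunLike.congr_fun BTensor.map_id (P.coact p)).symm
  mul_mem' {f g} hf hg := fun p => by
    change P.coact (f (g p)) = BTensor.map (f ∘ₗ g) LinearMap.id (P.coact p)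
    rw [hf, hg, BTensor.map_map]
    rfl
  zero_mem' := fun p => by
    rw [BTensor.map_zero_left]
    simp
  add_mem' {f g} hf hg := fun p => by
    rw [BTensor.map_add_left, LinearMap.add_apply, map_add, hf p, hg p]
    rfl
  neg_mem' {f} hf := fun p => by
    have h : BTensor.map (-f) LinearMap.id (P.coact p) +
        BTensor.map f LinearMap.id (P.coact p) = 0 := by
      rw [← AddMonoidHom.add_apply, ← BTensor.map_add_left, neg_add_cancel, BTensor.map_zero_left]
      rfl
    rw [LinearMap.neg_apply, map_neg, hf p]
    exact (eq_neg_of_add_eq_zero_left h).symm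

/-- `Hom_A(P, K)` is a right module over `S = End^C(P)` by `g s = g ∘ s`. -/
noncomputable instance homModule (P : Comod A C) (K : Type*) [AddCommGroup K] [Module Aᵐᵒᵖ K] :
    Module (P.endRing)ᵐᵒᵖ (P →ₗ[Aᵐᵒᵖ] K) where
  smul s g := g ∘ₗ (s.unop : Module.End Aᵐᵒᵖ P)
  one_smul _ := rfl
  mul_smul _ _ _ := rfl
  smul_zero _ := rfl
  smul_add _ _ _ := rfl
  add_smul s t g := by
    ext p
    exact map_add g _ _
  zero_smul g := by
    ext p
    exact map_zero g

/-- The canonical map `Hom_A(P, K) ⊗_S P → K ⊗_A C`, `g ⊗ p ↦ (g ⊗ I_C) (ϱ^P(p))`. -/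
noncomputable def galoisMap (P : Comod A C) (K : Type*) [AddCommGroup K] [Module Aᵐᵒᵖ K] :
    BTensor P.endRing (P →ₗ[Aᵐᵒᵖ] K) P →+ BTensor A K C :=
  BTensor.lift
    { toFun := fun g => (BTensor.map g LinearMap.id).comp P.coact.toAddMonoidHom
      map_zero' := by
        rw [BTensor.map_zero_left]
        rfl
      map_add' := fun g g' => by
        rw [BTensor.map_add_left]
        rfl }
    (fun s g p => by
      change BTensor.map (g ∘ₗ (s : Module.End Aᵐᵒᵖ P)) LinearMap.id (P.coact p) =
        BTensor.map g LinearMap.id (P.coact ((s : Module.End Aᵐᵒᵖ P) p))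
      rw [s.2 p, BTensor.map_map]
      rfl)

@[simp] theorem galoisMap_tmul (P : Comod A C) (K : Type*) [AddCommGroup K] [Module Aᵐᵒᵖ K]
    (g : P →ₗ[Aᵐᵒᵖ] K) (p : P) :
    P.galoisMap K (BTensor.tmul P.endRing g p) = BTensor.map g LinearMap.id (P.coact p) := rfl

/-- `P` is a Galois comodule: for every right `A`-module `K` the canonical map
`Hom_A(P, K) ⊗_S P → K ⊗_A C` (which is natural in `K` and a comodule morphism) is an
isomorphism. -/
def IsGalois (P : Comod A C) : Prop :=
  ∀ (K : Type u) [AddCommGroup K] [Module Aᵐᵒᵖ K], Function.Bijective (P.galoisMap K)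

end Comod

end Comodules

/-! The Galois isomorphism is natural in `K`, so the functor `- ⊗_A C` is the composite of `Hom_A(P,
-)` and `- ⊗_S P`. Since `Hom_A(P, -)` preserves products and injections, each property of a left
module that can be read off from tensoring with products or with injections passes from `P` over `S`
to `C` over `A`: finite generation (surjectivity of the product map, `piMap_comp_galoisMap`),
Mittag-Leffler (its injectivity), flatness, and finite presentation, which is the conjunction of the
first two.

Projectivity and local projectivity are transferred by dual bases: a section `P → S^(P)`, exact on a
finite set, is turned into a map `C → A^(C)` by applying the Galois isomorphism for `K = A`
(`IsGalois.linearCombination_inducedMap`).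

For the generator property, `Hom^C(P, M)` is the kernel of `defect`, and the Galois isomorphisms
turn `defect ⊗ P` into `ϱ^M ⊗ C - M ⊗ Δ`, whose kernel is `M`. If `P` is flat over `S`, evaluation
`Hom^C(P, M) ⊗_S P → M` is therefore bijective. Faithful flatness then reflects surjectivity from
`f` to `Hom^C(P, f)`. -/

namespace BTensor

/-! ### Tensor products over a noncommutative ring: finite sums, right exactness, associativity. -/

section Sums

variable {A M N : Type*} [Ring A] [AddCommGroup M] [Module Aᵐᵒᵖ M] [AddCommGroup N] [Module A N]

theorem tmul_zero (m : M) : tmul A m (0 : N) = 0 := map_zero (mk A M N m)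

theorem zero_tmul (n : N) : tmul A (0 : M) n = 0 := DFunLike.congr_fun (map_zero (mk A M N)) n

theorem tmul_sub (m : M) (n n' : N) : tmul A m (n - n') = tmul A m n - tmul A m n' :=
  map_sub (mk A M N m) n n'

theorem sub_tmul (m m' : M) (n : N) : tmul A (m - m') n = tmul A m n - tmul A m' n :=
  DFunLike.congr_fun (map_sub (mk A M N) m m') n

theorem tmul_sum {ι : Type*} (s : Finset ι) (m : M) (n : ι → N) :
    tmul A m (∑ i ∈ s, n i) = ∑ i ∈ s, tmul A m (n i) :=
  map_sum (mk A M N m) n s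

/-- Coefficients move to the left factor, so one fixed generating family serves all tensors; this
uniformity yields surjectivity of `piMap`. -/
theorem exists_eq_sum_of_span {ι : Type*} [Fintype ι] (v : ι → N)
    (hv : Submodule.span A (Set.range v) = ⊤) (x : BTensor A M N) :
    ∃ q : ι → M, x = ∑ i, tmul A (q i) (v i) := by
  induction x using induction_on with
  | tmul m n =>
    have hn : n ∈ Submodule.span A (Set.range v) := hv ▸ Submodule.mem_top
    obtain ⟨c, rfl⟩ := (Submodule.mem_span_range_iff_exists_fun A).1 hn
    exact ⟨fun i => op (c i) • m, by simp only [tmul_sum, op_smul_tmul]⟩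
  | add x y hx hy =>
    obtain ⟨q, rfl⟩ := hx
    obtain ⟨r, rfl⟩ := hy
    exact ⟨q + r, by simp only [Pi.add_apply, add_tmul, Finset.sum_add_distrib]⟩

theorem exists_eq_sum (x : BTensor A M N) :
    ∃ (n : ℕ) (u : Fin n → M) (v : Fin n → N), x = ∑ i, tmul A (u i) (v i) := by
  induction x using induction_on with
  | tmul m n => exact ⟨1, fun _ => m, fun _ => n, by simp⟩
  | add x y hx hy =>
    obtain ⟨k, u, v, rfl⟩ := hx
    obtain ⟨l, u', v', rfl⟩ := hy
    exact ⟨k + l, Fin.append u u', Fin.append v v', by simp [Fin.sum_univ_add]⟩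

end Sums

section Exactness

variable {A M N M' N' : Type*} [Ring A]
  [AddCommGroup M] [Module Aᵐᵒᵖ M] [AddCommGroup N] [Module A N]
  [AddCommGroup M'] [Module Aᵐᵒᵖ M'] [AddCommGroup N'] [Module A N']

theorem map_surjective {f : M →ₗ[Aᵐᵒᵖ] M'} {g : N →ₗ[A] N'} (hf : Function.Surjective f)
    (hg : Function.Surjective g) : Function.Surjective (map f g) := fun x => by
  induction x using induction_on with
  | tmul m n =>
    obtain ⟨m, rfl⟩ := hf m
    obtain ⟨n, rfl⟩ := hg n
    exact ⟨tmul A m n, rfl⟩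
  | add x y hx hy =>
    obtain ⟨x, rfl⟩ := hx
    obtain ⟨y, rfl⟩ := hy
    exact ⟨x + y, map_add _ x y⟩

theorem map_bijective_of_equiv (e : M ≃ₗ[Aᵐᵒᵖ] M') :
    Function.Bijective (map (e : M →ₗ[Aᵐᵒᵖ] M') (LinearMap.id : N →ₗ[A] N)) := by
  refine Function.bijective_iff_has_inverse.2
    ⟨map (e.symm : M' →ₗ[Aᵐᵒᵖ] M) LinearMap.id, fun x => ?_, fun x => ?_⟩
  · rw [map_map, LinearEquiv.symm_comp]
    exact DFunLike.congr_fun map_id x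
  · rw [map_map, LinearEquiv.comp_symm]
    exact DFunLike.congr_fun map_id x

/-- Right exactness of `M ⊗_A -`. -/
theorem exists_map_ker_right (f : N →ₗ[A] N') (hf : Function.Surjective f) (x : BTensor A M N)
    (hx : map (LinearMap.id : M →ₗ[Aᵐᵒᵖ] M) f x = 0) :
    ∃ y : BTensor A M (LinearMap.ker f), map LinearMap.id (LinearMap.ker f).subtype y = x := by
  set R : AddSubgroup (BTensor A M N) :=
    (map (LinearMap.id : M →ₗ[Aᵐᵒᵖ] M) (LinearMap.ker f).subtype).range
  -- A merely set-theoretic section becomes additive and balanced modulo the image `R`. The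
  -- resulting map `s` satisfies `s ∘ (id ⊗ f) = ` projection modulo `R`, so the kernel lies in `R`.
  let σ : N' → N := Function.surjInv hf
  have hσ (n : N') : f (σ n) = n := Function.surjInv_eq hf n
  have key (m : M) (n n' : N) (h : f n = f n') :
      (QuotientAddGroup.mk (tmul A m n) : BTensor A M N ⧸ R) = QuotientAddGroup.mk (tmul A m n') := by
    refine (QuotientAddGroup.eq_iff_sub_mem).2 ⟨tmul A m ⟨n - n', ?_⟩, ?_⟩
    · simp [h]
    · simp [tmul_sub]
  let s : BTensor A M N' →+ BTensor A M N ⧸ R :=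
    lift
      (AddMonoidHom.mk' (fun m => AddMonoidHom.mk'
          (fun n => (QuotientAddGroup.mk (tmul A m (σ n)) : BTensor A M N ⧸ R))
          (fun n n' => by
            rw [key m (σ (n + n')) (σ n + σ n') (by simp [hσ]), tmul_add]
            rfl))
        (fun m m' => by
          ext n
          exact congrArg QuotientAddGroup.mk (add_tmul m m' (σ n))))
      (fun a m n => by
        change QuotientAddGroup.mk (tmul A (op a • m) (σ n)) =
          QuotientAddGroup.mk (tmul A m (σ (a • n)))
        rw [op_smul_tmul]
        exact key m _ _ (by simp [hσ]))
  have hs : s.comp (map LinearMap.id f) = QuotientAddGroup.mk' R :=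
    addHom_ext fun m n => key m _ _ (hσ _)
  have hx' : QuotientAddGroup.mk' R x = 0 := by
    rw [← hs, AddMonoidHom.comp_apply, hx, map_zero]
  exact (QuotientAddGroup.eq_zero_iff x).1 hx'

/-- Right exactness of `- ⊗_A N`. -/
theorem exists_map_ker_left (f : M →ₗ[Aᵐᵒᵖ] M') (hf : Function.Surjective f) (x : BTensor A M N)
    (hx : map f (LinearMap.id : N →ₗ[A] N) x = 0) :
    ∃ y : BTensor A (LinearMap.ker f) N, map (LinearMap.ker f).subtype LinearMap.id y = x := by
  set R : AddSubgroup (BTensor A M N) :=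
    (map (LinearMap.ker f).subtype (LinearMap.id : N →ₗ[A] N)).range
  let σ : M' → M := Function.surjInv hf
  have hσ (m : M') : f (σ m) = m := Function.surjInv_eq hf m
  have key (m m' : M) (n : N) (h : f m = f m') :
      (QuotientAddGroup.mk (tmul A m n) : BTensor A M N ⧸ R) = QuotientAddGroup.mk (tmul A m' n) := by
    refine (QuotientAddGroup.eq_iff_sub_mem).2 ⟨tmul A ⟨m - m', ?_⟩ n, ?_⟩
    · simp [h]
    · simp [sub_tmul]
  let s : BTensor A M' N →+ BTensor A M N ⧸ R :=
    lift
      (AddMonoidHom.mk' (fun m => AddMonoidHom.mk'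
          (fun n => (QuotientAddGroup.mk (tmul A (σ m) n) : BTensor A M N ⧸ R))
          (fun n n' => congrArg QuotientAddGroup.mk (tmul_add (σ m) n n')))
        (fun m m' => by
          ext n
          change QuotientAddGroup.mk _ = QuotientAddGroup.mk _
          rw [key (σ (m + m')) (σ m + σ m') n (by simp [hσ]), add_tmul]))
      (fun a m n => by
        change QuotientAddGroup.mk (tmul A (σ (op a • m)) n) =
          QuotientAddGroup.mk (tmul A (σ m) (a • n))
        rw [← op_smul_tmul]
        exact key _ _ n (by simp [hσ]))
  have hs : s.comp (map f LinearMap.id) = QuotientAddGroup.mk' R :=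
    addHom_ext fun m n => key _ _ n (hσ _)
  have hx' : QuotientAddGroup.mk' R x = 0 := by
    rw [← hs, AddMonoidHom.comp_apply, hx, map_zero]
  exact (QuotientAddGroup.eq_zero_iff x).1 hx'

end Exactness

theorem piMap_apply {A N : Type*} [Ring A] [AddCommGroup N] [Module A N] {ι : Type*}
    (Q : ι → Type*) [∀ i, AddCommGroup (Q i)] [∀ i, Module Aᵐᵒᵖ (Q i)]
    (x : BTensor A (∀ i, Q i) N) (i : ι) :
    piMap A N Q x i = map (LinearMap.proj i) LinearMap.id x := rfl

section Assoc

variable (A M X N : Type*) [Ring A] [AddCommGroup M] [Module Aᵐᵒᵖ M]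
  [AddCommGroup X] [Module A X] [Module Aᵐᵒᵖ X] [SMulCommClass A Aᵐᵒᵖ X]
  [AddCommGroup N] [Module A N]

/-- The biadditive map `(m, z) ↦ (m ⊗ x) ⊗ n` for `z = x ⊗ n`. -/
noncomputable def assocInvAux : M →+ BTensor A X N →+ BTensor A (BTensor A M X) N :=
  AddMonoidHom.mk'
    (fun m => lift ((mk A (BTensor A M X) N).comp (mk A M X m))
      (fun a x n => op_smul_tmul a (tmul A m x) n))
    (fun m m' => addHom_ext fun x n => by
      change tmul A (tmul A (m + m') x) n = tmul A (tmul A m x) n + tmul A (tmul A m' x) n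
      rw [add_tmul, add_tmul])

theorem assocInvAux_smul (a : A) (m : M) (z : BTensor A X N) :
    assocInvAux A M X N (op a • m) z = assocInvAux A M X N m (a • z) := by
  induction z using induction_on with
  | tmul x n => exact congrArg (tmul A · n) (op_smul_tmul a m x)
  | add y z hy hz => simp only [smul_add, map_add, hy, hz]

/-- The canonical map `M ⊗_A (X ⊗_A N) → (M ⊗_A X) ⊗_A N`, `m ⊗ (x ⊗ n) ↦ (m ⊗ x) ⊗ n`. -/
noncomputable def assocInv : BTensor A M (BTensor A X N) →+ BTensor A (BTensor A M X) N :=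
  lift (assocInvAux A M X N) (assocInvAux_smul A M X N)

theorem assocInv_assoc (x : BTensor A (BTensor A M X) N) :
    assocInv A M X N (assoc A M X N x) = x := by
  induction x using induction_on with
  | tmul y n =>
    induction y using induction_on with
    | tmul m x => rfl
    | add y z hy hz => simp only [add_tmul, map_add, hy, hz]
  | add y z hy hz => simp only [map_add, hy, hz]

theorem assoc_injective : Function.Injective (assoc A M X N) :=
  Function.LeftInverse.injective (assocInv_assoc A M X N)

end Assoc

end BTensor

/-! ### Criteria for finiteness, finite presentation, flatness and local projectivity. -/

section ModuleProperties

open BTensor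

variable {R : Type u} {M : Type u} [Ring R] [AddCommGroup M] [Module R M]

theorem BTensor.piMap_surjective_of_span {R M : Type*} [Ring R] [AddCommGroup M] [Module R M]
    {κ : Type*} [Fintype κ] (v : κ → M)
    (hv : Submodule.span R (Set.range v) = ⊤) {ι : Type*} (Q : ι → Type*)
    [∀ i, AddCommGroup (Q i)] [∀ i, Module Rᵐᵒᵖ (Q i)] :
    Function.Surjective (piMap R M Q) := fun x => by
  choose q hq using fun i => exists_eq_sum_of_span v hv (x i)
  refine ⟨∑ k, tmul R (fun i => q i k) (v k), funext fun i => ?_⟩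
  simp only [hq i, piMap_apply, map_sum, map_tmul, LinearMap.proj_apply, LinearMap.id_apply]

theorem Module.Finite.piMap_surjective [Module.Finite R M] {ι : Type*} (Q : ι → Type*)
    [∀ i, AddCommGroup (Q i)] [∀ i, Module Rᵐᵒᵖ (Q i)] :
    Function.Surjective (piMap R M Q) := by
  obtain ⟨s, hs⟩ := Module.Finite.fg_top (R := R) (M := M)
  exact piMap_surjective_of_span (fun x : s => (x : M)) (by simpa using hs) Q

theorem Submodule.fg_of_forall_eq_sum {n : ℕ} {κ : Type*} {N : Submodule R M} (g : Fin n → N)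
    (f : Fin n → κ → R) (c : κ → M) (hc : ∀ x ∈ N, ∃ k, c k = x)
    (h : ∀ k, ∑ i, f i k • (g i : M) = c k) : N.FG := by
  refine Submodule.fg_def.2 ⟨Set.range fun i => (g i : M), Set.finite_range _, le_antisymm ?_ ?_⟩
  · rw [Submodule.span_le]
    rintro _ ⟨i, rfl⟩
    exact (g i).2
  · intro x hx
    obtain ⟨k, rfl⟩ := hc x hx
    rw [← h k]
    exact Submodule.sum_mem _ fun i _ => Submodule.smul_mem _ _ (Submodule.subset_span ⟨i, rfl⟩)

/-- A module is finite as soon as `R^M ⊗ M → (R ⊗ M)^M` is surjective. -/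
theorem Module.Finite.of_piMap_surjective
    (h : Function.Surjective (piMap R M fun _ : M => R)) : Module.Finite R M := by
  -- The family is indexed by `M` itself: coordinate `m` of a preimage `∑ u_i ⊗ v_i` reads `m = ∑
  -- u_i(m) v_i`.
  obtain ⟨x, hx⟩ := h fun m => tmul R 1 m
  obtain ⟨n, u, v, rfl⟩ := exists_eq_sum x
  refine ⟨Submodule.fg_of_forall_eq_sum (fun i => ⟨v i, Submodule.mem_top⟩) u id
    (fun x _ => ⟨x, rfl⟩) fun k => ?_⟩
  simpa only [piMap_apply, map_sum, map_tmul, lid_tmul, one_smul, LinearMap.id_apply,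
    LinearMap.proj_apply, id_eq] using
    congrArg (lid R M) (congrFun hx k)

/-- The canonical map `Q ⊗_R Rⁿ → Qⁿ`. -/
noncomputable def BTensor.piScalar (R Q : Type*) [Ring R] [AddCommGroup Q] [Module Rᵐᵒᵖ Q] (n : ℕ) :
    BTensor R Q (Fin n → R) →+ (Fin n → Q) :=
  AddMonoidHom.pi fun i => (rid R Q).comp (BTensor.map LinearMap.id (LinearMap.proj i))

theorem BTensor.piScalar_apply {R Q : Type*} [Ring R] [AddCommGroup Q] [Module Rᵐᵒᵖ Q] {n : ℕ}
    (x : BTensor R Q (Fin n → R)) (i : Fin n) :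
    piScalar R Q n x i = rid R Q (BTensor.map LinearMap.id (LinearMap.proj i) x) := rfl

theorem BTensor.span_range_single (R : Type*) [Ring R] (n : ℕ) :
    Submodule.span R (Set.range fun i : Fin n => (Pi.single i 1 : Fin n → R)) = ⊤ := by
  rw [← (Pi.basisFun R (Fin n)).span_eq]
  congr 2
  ext1 i
  rw [Pi.basisFun_apply]

theorem BTensor.piScalar_sum_single {R Q : Type*} [Ring R] [AddCommGroup Q] [Module Rᵐᵒᵖ Q] {n : ℕ}
    (q : Fin n → Q) : piScalar R Q n (∑ i, tmul R (q i) (Pi.single i 1)) = q := by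
  ext j
  rw [piScalar_apply, map_sum, map_sum, Finset.sum_eq_single j]
  · simp only [map_tmul, rid_tmul, LinearMap.id_apply, LinearMap.proj_apply, Pi.single_eq_same,
      op_one, one_smul]
  · intro i _ hi
    simp only [map_tmul, rid_tmul, LinearMap.id_apply, LinearMap.proj_apply,
      Pi.single_eq_of_ne hi.symm, op_zero, zero_smul]
  · simp

theorem BTensor.piScalar_injective (R Q : Type*) [Ring R] [AddCommGroup Q] [Module Rᵐᵒᵖ Q] (n : ℕ) :
    Function.Injective (piScalar R Q n) := by
  refine (injective_iff_map_eq_zero _).2 fun x hx => ?_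
  obtain ⟨q, rfl⟩ := exists_eq_sum_of_span _ (span_range_single R n) x
  rw [piScalar_sum_single] at hx
  simp only [hx, Pi.zero_apply, zero_tmul, Finset.sum_const_zero]

/-- A diagram chase on `ker f → Rⁿ → M`: the product map is injective for `Rⁿ` and surjective for
the finitely generated kernel. -/
theorem IsMittagLefflerModule.of_finitePresentation [Module.FinitePresentation R M] :
    IsMittagLefflerModule R M := by
  intro ι Q _ _
  obtain ⟨n, f, hf⟩ := Module.Finite.exists_fin' R M
  have hK : Module.Finite R (LinearMap.ker f) := .of_fg (Module.FinitePresentation.fg_ker f hf)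
  refine (injective_iff_map_eq_zero _).2 fun x hx => ?_
  obtain ⟨x, rfl⟩ := map_surjective (M := ∀ i, Q i) (f := LinearMap.id) Function.surjective_id hf x
  have nat {N N' : Type u} [AddCommGroup N] [Module R N] [AddCommGroup N'] [Module R N']
      (f : N →ₗ[R] N') (x : BTensor R (∀ i, Q i) N) (i : ι) :
      piMap R N' Q (BTensor.map LinearMap.id f x) i =
        BTensor.map LinearMap.id f (piMap R N Q x i) := by
    rw [piMap_apply, piMap_apply, map_map, map_map]
    rfl
  -- Each coordinate of `x` comes from `ker f`; finite generation of `ker f` assembles these into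
  -- one tensor.
  choose y hy using fun i => exists_map_ker_right f hf (piMap R _ Q x i)
    (by rw [← nat, hx]; rfl)
  obtain ⟨y, rfl⟩ := Module.Finite.piMap_surjective Q y
  have : BTensor.map LinearMap.id (LinearMap.ker f).subtype y = x := by
    apply piScalar_injective R
    ext j i
    have := congrArg (fun z => piScalar R (Q i) n z j) (((nat _ y i).trans (hy i)))
    have comm (z : BTensor R (∀ i, Q i) (Fin n → R)) :
        piScalar R (Q i) n (piMap R _ Q z i) j = piScalar R (∀ i, Q i) n z j i := by
      induction z using BTensor.induction_on with
      | tmul q v => rfl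
      | add y z hy hz => simp only [map_add, Pi.add_apply, hy, hz]
    simpa only [comm] using this
  rw [← this, map_map, LinearMap.comp_ker_subtype, map_zero_right]
  rfl

theorem IsMittagLefflerModule.finitePresentation [Module.Finite R M]
    (h : IsMittagLefflerModule R M) : Module.FinitePresentation R M := by
  obtain ⟨n, f, hf⟩ := Module.Finite.exists_fin' R M
  refine Module.finitePresentation_of_surjective f hf ?_
  -- The universal relation: its coordinate at `k` is `∑ k_j ⊗ e_j = 1 ⊗ k`, which `f` kills. By the
  -- Mittag-Leffler property `f` kills `x` itself, so `x` lifts to a finite sum with right factors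
  -- in `ker f`, and these generate `ker f`.
  let x : BTensor R (LinearMap.ker f → R) (Fin n → R) :=
    ∑ j, tmul R (fun k => (k : Fin n → R) j) (Pi.single j 1)
  have hx : BTensor.map LinearMap.id f x = 0 := by
    apply h (LinearMap.ker f) fun _ => R
    rw [map_zero]
    funext k
    have e (j : Fin n) : tmul R ((k : Fin n → R) j) (f (Pi.single j 1)) =
        tmul R (1 : R) (f (Pi.single j ((k : Fin n → R) j))) := by
      have : (Pi.single j ((k : Fin n → R) j) : Fin n → R) = (k : Fin n → R) j • Pi.single j 1 := by
        rw [← Pi.single_smul, smul_eq_mul, mul_one]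
      rw [this, map_smul, ← op_smul_tmul, op_smul_eq_mul, one_mul]
    simp only [x, piMap_apply, map_sum, map_tmul, LinearMap.id_apply, LinearMap.proj_apply, e]
    rw [← tmul_sum, ← map_sum, Finset.univ_sum_single, LinearMap.mem_ker.1 k.2, tmul_zero]
    rfl
  obtain ⟨y, hy⟩ := exists_map_ker_right f hf x hx
  obtain ⟨m, u, v, rfl⟩ := exists_eq_sum y
  refine Submodule.fg_of_forall_eq_sum v u Subtype.val (fun x hx => ⟨⟨x, hx⟩, rfl⟩) fun k => ?_
  ext j
  have := congrFun (congrFun (congrArg (piScalar R (LinearMap.ker f → R) n) hy) j) k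
  rw [piScalar_sum_single, piScalar_apply] at this
  simpa only [map_sum, map_tmul, rid_tmul, LinearMap.id_apply, LinearMap.proj_apply,
    Submodule.subtype_apply, Finset.sum_apply, Pi.smul_apply, op_smul_eq_mul, smul_eq_mul]
    using this

/-- Factor `f` through its range: flatness handles the inclusion, right exactness the surjection. -/
theorem IsFlatModule.exists_map_ker (h : IsFlatModule R M) {X Y : Type u} [AddCommGroup X]
    [AddCommGroup Y] [Module Rᵐᵒᵖ X] [Module Rᵐᵒᵖ Y] (f : X →ₗ[Rᵐᵒᵖ] Y) (x : BTensor R X M)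
    (hx : BTensor.map f LinearMap.id x = 0) :
    ∃ y : BTensor R (LinearMap.ker f) M,
      BTensor.map (LinearMap.ker f).subtype LinearMap.id y = x := by
  have := exists_map_ker_left f.rangeRestrict f.surjective_rangeRestrict x (by
    apply h _ _ (LinearMap.range f).subtype Subtype.val_injective
    rw [map_map, map_zero]
    exact hx)
  rwa [LinearMap.ker_rangeRestrict] at this

/-- Local sections of `(M →₀ R) → M` exist as soon as `M` is locally projective. -/
theorem IsLocallyProjectiveModule.exists_section (h : IsLocallyProjectiveModule R M)
    (F : Submodule R M) (hF : F.FG) :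
    ∃ s : M →ₗ[R] M →₀ R, ∀ x ∈ F, Finsupp.linearCombination R id (s x) = x :=
  h _ _ (Finsupp.linearCombination R (id : M → M)) LinearMap.id F
    (Finsupp.linearCombination_id_surjective R M) hF

/-- On the free module `g` lifts basis element by basis element; composing with `s` gives a lift
that is correct wherever `s` splits. -/
theorem IsLocallyProjectiveModule.of_exists_section
    (h : ∀ F : Finset M, ∃ s : M →ₗ[R] M →₀ R, ∀ x ∈ F, Finsupp.linearCombination R id (s x) = x) :
    IsLocallyProjectiveModule R M := by
  rintro L N _ _ _ _ f g _ hf ⟨F, rfl⟩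
  obtain ⟨s, hs⟩ := h F
  refine ⟨Finsupp.linearCombination R (fun m => Function.surjInv hf (g m)) ∘ₗ s, fun x hx => ?_⟩
  rw [LinearMap.comp_apply, Finsupp.apply_linearCombination]
  have : f ∘ (fun m => Function.surjInv hf (g m)) = g ∘ id :=
    funext fun m => Function.surjInv_eq hf (g m)
  rw [this, ← Finsupp.apply_linearCombination]
  congr 1
  exact LinearMap.eqOn_span (f := Finsupp.linearCombination R id ∘ₗ s) (g := LinearMap.id) hs hx

end ModuleProperties

/-- The right linear map `f ⊗ N`, for a bimodule `N`. -/
noncomputable def BTensor.mapRight {A M M' : Type*} (N : Type*) [Ring A] [AddCommGroup M]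
    [Module Aᵐᵒᵖ M] [AddCommGroup M'] [Module Aᵐᵒᵖ M'] [AddCommGroup N] [Module A N]
    [Module Aᵐᵒᵖ N] [SMulCommClass A Aᵐᵒᵖ N] (f : M →ₗ[Aᵐᵒᵖ] M') :
    BTensor A M N →ₗ[Aᵐᵒᵖ] BTensor A M' N where
  toFun := map f LinearMap.id
  map_add' := map_add _
  map_smul' a x := by
    induction x using induction_on with
    | tmul m n => rfl
    | add x y hx hy => simp only [smul_add, map_add, hx, hy]

theorem BTensor.mapRight_apply {A M M' N : Type*} [Ring A] [AddCommGroup M]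
    [Module Aᵐᵒᵖ M] [AddCommGroup M'] [Module Aᵐᵒᵖ M'] [AddCommGroup N] [Module A N]
    [Module Aᵐᵒᵖ N] [SMulCommClass A Aᵐᵒᵖ N] (f : M →ₗ[Aᵐᵒᵖ] M') (x : BTensor A M N) :
    mapRight N f x = map f LinearMap.id x := rfl

theorem BTensor.assoc_map_mapRight {A M M' X N : Type*} [Ring A] [AddCommGroup M]
    [Module Aᵐᵒᵖ M] [AddCommGroup M'] [Module Aᵐᵒᵖ M'] [AddCommGroup X] [Module A X]
    [Module Aᵐᵒᵖ X] [SMulCommClass A Aᵐᵒᵖ X] [AddCommGroup N] [Module A N]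
    (f : M →ₗ[Aᵐᵒᵖ] M') (x : BTensor A (BTensor A M X) N) :
    assoc A M' X N (map (mapRight X f) LinearMap.id x) =
      map f LinearMap.id (assoc A M X N x) := by
  induction x using induction_on with
  | tmul y n =>
    induction y using induction_on with
    | tmul m x => rfl
    | add y z hy hz => simp only [add_tmul, map_add, hy, hz]
  | add y z hy hz => simp only [map_add, hy, hz]

theorem BTensor.map_sub_left {A M N M' N' : Type*} [Ring A]
    [AddCommGroup M] [Module Aᵐᵒᵖ M] [AddCommGroup N] [Module A N]
    [AddCommGroup M'] [Module Aᵐᵒᵖ M'] [AddCommGroup N'] [Module A N']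
    (f f' : M →ₗ[Aᵐᵒᵖ] M') (g : N →ₗ[A] N') : map (f - f') g = map f g - map f' g :=
  addHom_ext fun _ _ => sub_tmul _ _ _

namespace Comod

open BTensor

variable {A C : Type u} [Ring A] [AddCommGroup C] [Module A C] [Module Aᵐᵒᵖ C]
  [SMulCommClass A Aᵐᵒᵖ C] [Coring A C] (P : Comod A C)

/-! ### Naturality of the Galois map; transfer of finiteness, Mittag-Leffler and flatness. -/

section Galois

variable {K L : Type*} [AddCommGroup K] [Module Aᵐᵒᵖ K] [AddCommGroup L] [Module Aᵐᵒᵖ L]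

/-- The map `Hom_A(P, f)`. -/
def postcomp (f : K →ₗ[Aᵐᵒᵖ] L) : (P →ₗ[Aᵐᵒᵖ] K) →ₗ[(P.endRing)ᵐᵒᵖ] (P →ₗ[Aᵐᵒᵖ] L) where
  toFun g := f ∘ₗ g
  map_add' _ _ := LinearMap.comp_add _ _ _
  map_smul' _ _ := rfl

theorem galoisMap_map_postcomp (f : K →ₗ[Aᵐᵒᵖ] L) (x : BTensor P.endRing (P →ₗ[Aᵐᵒᵖ] K) P) :
    P.galoisMap L (map (P.postcomp f) LinearMap.id x) =
      map f LinearMap.id (P.galoisMap K x) := by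
  induction x using BTensor.induction_on with
  | tmul g p =>
    rw [galoisMap_tmul, map_map]
    rfl
  | add x y hx hy => simp only [map_add, hx, hy]

/-- The isomorphism `Hom_A(P, ∏ Q_i) ≃ ∏ Hom_A(P, Q_i)`. -/
def homPiEquiv {ι : Type*} (Q : ι → Type*) [∀ i, AddCommGroup (Q i)] [∀ i, Module Aᵐᵒᵖ (Q i)] :
    (P →ₗ[Aᵐᵒᵖ] ∀ i, Q i) ≃ₗ[(P.endRing)ᵐᵒᵖ] ∀ i, P →ₗ[Aᵐᵒᵖ] Q i where
  toFun g i := LinearMap.proj i ∘ₗ g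
  invFun g := LinearMap.pi g
  map_add' _ _ := rfl
  map_smul' _ _ := rfl
  left_inv _ := rfl
  right_inv _ := rfl

theorem piMap_galoisMap {ι : Type*} (Q : ι → Type*) [∀ i, AddCommGroup (Q i)]
    [∀ i, Module Aᵐᵒᵖ (Q i)] (x : BTensor P.endRing (P →ₗ[Aᵐᵒᵖ] ∀ i, Q i) P) (i : ι) :
    piMap A C Q (P.galoisMap _ x) i = P.galoisMap (Q i)
      (piMap P.endRing P (fun i => P →ₗ[Aᵐᵒᵖ] Q i)
        (map (P.homPiEquiv Q : (P →ₗ[Aᵐᵒᵖ] ∀ i, Q i) →ₗ[(P.endRing)ᵐᵒᵖ] ∀ i, P →ₗ[Aᵐᵒᵖ] Q i)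
          LinearMap.id x) i) := by
  rw [piMap_apply, piMap_apply, map_map, ← galoisMap_map_postcomp]
  rfl

variable {P}

/-- For Galois `P` all maps here other than the two `piMap`s are bijections, so the product map of
`C` inherits injectivity or surjectivity from that of `P`. -/
theorem piMap_comp_galoisMap (ι : Type u) (Q : ι → Type u) [∀ i, AddCommGroup (Q i)]
    [∀ i, Module Aᵐᵒᵖ (Q i)] :
    piMap A C Q ∘ P.galoisMap _ = Pi.map (fun i => P.galoisMap (Q i)) ∘
      piMap P.endRing P (fun i => P →ₗ[Aᵐᵒᵖ] Q i) ∘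
        map (P.homPiEquiv Q : (P →ₗ[Aᵐᵒᵖ] ∀ i, Q i) →ₗ[(P.endRing)ᵐᵒᵖ] ∀ i, P →ₗ[Aᵐᵒᵖ] Q i)
          LinearMap.id :=
  funext fun x => funext fun i => piMap_galoisMap P Q x i

theorem IsGalois.finite (hP : P.IsGalois) [Module.Finite P.endRing P] : Module.Finite A C := by
  refine Module.Finite.of_piMap_surjective (Function.Surjective.of_comp (g := P.galoisMap _) ?_)
  rw [piMap_comp_galoisMap]
  exact (Function.Surjective.piMap fun i => (hP _).2).comp
    ((Module.Finite.piMap_surjective _).comp (map_bijective_of_equiv _).2)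

theorem IsGalois.isMittagLeffler (hP : P.IsGalois) (h : IsMittagLefflerModule P.endRing P) :
    IsMittagLefflerModule A C := fun ι Q _ _ => by
  rw [← Function.Injective.of_comp_iff' _ (hP _), piMap_comp_galoisMap]
  exact (Function.Injective.piMap fun i => (hP _).1).comp
    ((h ι _).comp (map_bijective_of_equiv _).1)

theorem IsGalois.isFlat (hP : P.IsGalois) (h : IsFlatModule P.endRing P) : IsFlatModule A C :=
  fun X Y _ _ _ _ f hf => by
    have hf' : Function.Injective (P.postcomp f) := fun g g' hg =>
      LinearMap.ext fun p => hf (DFunLike.congr_fun (F := P →ₗ[Aᵐᵒᵖ] Y) hg p)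
    rw [← Function.Injective.of_comp_iff' _ (hP X)]
    have : map f LinearMap.id ∘ P.galoisMap X =
        P.galoisMap Y ∘ map (P.postcomp f) LinearMap.id :=
      funext fun x => (galoisMap_map_postcomp P f x).symm
    rw [this]
    exact (hP Y).1.comp (h _ _ _ hf')

end Galois

/-! ### Transfer of projectivity and local projectivity by dual bases. -/

section Sections

/-- For a chosen decomposition `ϱ(p) = ∑ u_i ⊗ v_i`, the map `g ↦ ∑ g(u_i) [v_i]`. -/
noncomputable def expand (p : P) : (P →ₗ[Aᵐᵒᵖ] A) →+ (C →₀ A) :=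
  AddMonoidHom.mk'
    (fun g => ∑ i, Finsupp.single ((exists_eq_sum (P.coact p)).choose_spec.choose_spec.choose i)
      (g ((exists_eq_sum (P.coact p)).choose_spec.choose i)))
    (fun g g' => by
      simp only [LinearMap.add_apply, Finsupp.single_add, Finset.sum_add_distrib])

theorem linearCombination_expand (p : P) (g : P →ₗ[Aᵐᵒᵖ] A) :
    Finsupp.linearCombination A id (P.expand p g) =
      lid A C (map g LinearMap.id (P.coact p)) := by
  conv_rhs => rw [(exists_eq_sum (P.coact p)).choose_spec.choose_spec.choose_spec]
  simp only [expand, AddMonoidHom.mk'_apply, map_sum, Finsupp.linearCombination_single, map_tmul,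
    lid_tmul, id_eq, LinearMap.id_apply]

/-- The decomposition is chosen from `p` alone, hence left linearity in `g`; no dependence on `p` is
claimed. -/
theorem expand_postcomp (p : P) (a : A) (g : P →ₗ[Aᵐᵒᵖ] A) :
    P.expand p (P.postcomp (Module.toModuleEnd Aᵐᵒᵖ (S := A) A a) g) = a • P.expand p g := by
  simp only [expand, AddMonoidHom.mk'_apply, Finset.smul_sum, Finsupp.smul_single]
  rfl

variable {P} (s : P →ₗ[P.endRing] P →₀ P.endRing)

/-- The map `g ⊗ q ↦ ∑ expand p (g σ_p)` where `s q = ∑ σ_p [p]`. -/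
noncomputable def contract : BTensor P.endRing (P →ₗ[Aᵐᵒᵖ] A) P →+ (C →₀ A) :=
  lift
    (AddMonoidHom.mk'
      (fun g => (Finsupp.liftAddHom fun p =>
        (P.expand p).comp (AddMonoidHom.mk' (fun σ : P.endRing => op σ • g)
          (fun σ τ => add_smul (op σ) (op τ) g))).comp s.toAddMonoidHom)
      (fun g g' => by
        ext1 q
        change (s q).sum (fun p σ => P.expand p (op σ • (g + g'))) =
          (s q).sum (fun p σ => P.expand p (op σ • g)) +
            (s q).sum fun p σ => P.expand p (op σ • g')
        simp only [smul_add, map_add]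
        exact Finsupp.sum_add))
    (fun τ g q => by
      change (s q).sum (fun p σ => P.expand p (op σ • op τ • g)) =
        (s (τ • q)).sum fun p σ => P.expand p (op σ • g)
      rw [map_smul, Finsupp.sum_smul_index fun p => by rw [op_zero, zero_smul, map_zero]]
      exact Finsupp.sum_congr fun p _ => by rw [op_mul, mul_smul])

theorem contract_tmul (g : P →ₗ[Aᵐᵒᵖ] A) (q : P) :
    contract s (tmul P.endRing g q) = (s q).sum fun p σ => P.expand p (op σ • g) := rfl

theorem contract_postcomp (a : A) (x : BTensor P.endRing (P →ₗ[Aᵐᵒᵖ] A) P) :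
    contract s (map (P.postcomp (Module.toModuleEnd Aᵐᵒᵖ (S := A) A a)) LinearMap.id x) =
      a • contract s x := by
  induction x using BTensor.induction_on with
  | tmul g q =>
    rw [map_tmul, contract_tmul, contract_tmul, Finsupp.smul_sum]
    exact Finsupp.sum_congr fun p _ => by
      rw [← map_smul, expand_postcomp]
  | add x y hx hy => simp only [map_add, hx, hy, smul_add]

/-- If `q = ∑ σ_p p`, then `g ⊗ q = ∑ g σ_p ⊗ p`, and each summand is recovered from its expansion.
Only the splitting at `q` is needed. -/
theorem linearCombination_contract_tmul (g : P →ₗ[Aᵐᵒᵖ] A) (q : P)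
    (hq : Finsupp.linearCombination P.endRing id (s q) = q) :
    Finsupp.linearCombination A id (contract s (tmul P.endRing g q)) =
      lid A C (P.galoisMap A (tmul P.endRing g q)) := by
  conv_rhs => rw [← hq, Finsupp.linearCombination_apply, Finsupp.sum, tmul_sum, map_sum, map_sum]
  rw [contract_tmul, Finsupp.sum, map_sum]
  refine Finset.sum_congr rfl fun p _ => ?_
  rw [linearCombination_expand, ← op_smul_tmul]
  rfl

/-- The left `A`-linear map `C → A^(C)` induced by an `S`-linear map `P → S^(P)`. -/
noncomputable def IsGalois.inducedMap (hP : P.IsGalois) : C →ₗ[A] C →₀ A where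
  toFun c := contract s ((AddEquiv.ofBijective _ (hP A)).symm (tmul A 1 c))
  map_add' c c' := by rw [tmul_add, map_add, map_add]
  map_smul' a c := by
    -- Left multiplication by `a` is an endomorphism of the right module `A`, so naturality of the
    -- Galois map gives linearity.
    rw [RingHom.id_apply, ← contract_postcomp]
    congr 1
    rw [AddEquiv.symm_apply_eq, AddEquiv.ofBijective_apply, galoisMap_map_postcomp,
      ← AddEquiv.ofBijective_apply _ (hP A), AddEquiv.apply_symm_apply, map_tmul, ← op_smul_tmul]
    simp

/-- `F` consists of the right factors of the Galois preimage of `1 ⊗ c`. It does not depend on `s`,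
so global and local sections are covered alike. -/
theorem IsGalois.linearCombination_inducedMap (hP : P.IsGalois) (c : C) :
    ∃ F : Finset P, ∀ s : P →ₗ[P.endRing] P →₀ P.endRing,
      (∀ q ∈ F, Finsupp.linearCombination P.endRing id (s q) = q) →
        Finsupp.linearCombination A id (hP.inducedMap s c) = c := by
  classical
  obtain ⟨n, u, v, h⟩ := exists_eq_sum ((AddEquiv.ofBijective _ (hP A)).symm (tmul A 1 c))
  refine ⟨Finset.univ.image v, fun s hs => ?_⟩
  have h' := (AddEquiv.symm_apply_eq _).1 h
  rw [AddEquiv.ofBijective_apply] at h'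
  change Finsupp.linearCombination A id (contract s _) = c
  rw [h, map_sum, map_sum, Finset.sum_congr rfl fun i _ => linearCombination_contract_tmul s (u i)
    (v i) (hs _ (Finset.mem_image_of_mem _ (Finset.mem_univ i))), ← map_sum, ← map_sum, ← h',
    lid_tmul, one_smul]

theorem IsGalois.projective (hP : P.IsGalois) [h : Module.Projective P.endRing P] :
    Module.Projective A C := by
  obtain ⟨s, hs⟩ := h.out
  refine ⟨hP.inducedMap s, fun c => ?_⟩
  obtain ⟨F, hF⟩ := hP.linearCombination_inducedMap c
  exact hF s fun q _ => hs q

theorem IsGalois.isLocallyProjective (hP : P.IsGalois)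
    (h : IsLocallyProjectiveModule P.endRing P) : IsLocallyProjectiveModule A C := by
  classical
  refine .of_exists_section fun G => ?_
  choose F hF using hP.linearCombination_inducedMap
  obtain ⟨s, hs⟩ := h.exists_section (Submodule.span _ (G.biUnion F : Finset P)) ⟨_, rfl⟩
  exact ⟨hP.inducedMap s, fun c hc => hF c s fun q hq =>
    hs q (Submodule.subset_span (Finset.mem_biUnion.2 ⟨c, hc, hq⟩))⟩

end Sections

/-! ### Evaluation `Hom^C(P, M) ⊗_S P → M` and the generator property. -/

section Evaluation

variable (M : Comod A C)

/-- The map `g ↦ ϱ^M g - (g ⊗ C) ϱ^P`, whose kernel consists of the comodule morphisms. -/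
noncomputable def defect :
    (P →ₗ[Aᵐᵒᵖ] M) →ₗ[(P.endRing)ᵐᵒᵖ] (P →ₗ[Aᵐᵒᵖ] BTensor A M C) where
  toFun g := M.coact ∘ₗ g - mapRight C g ∘ₗ P.coact
  map_add' g g' := by
    ext p
    simp only [LinearMap.sub_apply, LinearMap.add_apply, LinearMap.comp_apply, mapRight_apply,
      map_add_left, map_add, AddMonoidHom.add_apply]
    abel
  map_smul' s g := by
    ext p
    change M.coact (g (s.unop • p)) - map (g ∘ₗ (s.unop : Module.End Aᵐᵒᵖ P)) LinearMap.id
      (P.coact p) = M.coact (g (s.unop • p)) - map g LinearMap.id (P.coact (s.unop • p))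
    rw [show P.coact (s.unop • p) = _ from s.unop.2 p, map_map]
    rfl

/-- `Hom^C(P, M)` as a right module over `S`. -/
noncomputable abbrev homC : Submodule (P.endRing)ᵐᵒᵖ (P →ₗ[Aᵐᵒᵖ] M) :=
  LinearMap.ker (P.defect M)

variable {P M}

theorem mem_homC {g : P →ₗ[Aᵐᵒᵖ] M} :
    g ∈ P.homC M ↔ ∀ p, M.coact (g p) = map g LinearMap.id (P.coact p) :=
  LinearMap.mem_ker.trans (LinearMap.ext_iff.trans (forall_congr' fun _ => sub_eq_zero))

variable (P M)

/-- Coassociativity of `P` rewrites the second term of `defect` as `M ⊗ Δ`. -/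
theorem assoc_galoisMap_defect (x : BTensor P.endRing (P →ₗ[Aᵐᵒᵖ] M) P) :
    assoc A M C C (P.galoisMap _ (map (P.defect M) LinearMap.id x)) =
      assoc A M C C (map M.coact LinearMap.id (P.galoisMap M x)) -
        map LinearMap.id (Coring.comul (A := A) (C := C)).left (P.galoisMap M x) := by
  induction x using BTensor.induction_on with
  | tmul g p =>
    change assoc A M C C (map (M.coact ∘ₗ g - mapRight C g ∘ₗ P.coact) LinearMap.id (P.coact p)) =
      assoc A M C C (map M.coact LinearMap.id (map g LinearMap.id (P.coact p))) -
        map LinearMap.id (Coring.comul (A := A) (C := C)).left (map g LinearMap.id (P.coact p))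
    have h := assoc_map_mapRight g (map P.coact LinearMap.id (P.coact p))
    rw [P.coassoc, map_map, map_map] at h
    rw [map_sub_left, AddMonoidHom.sub_apply, map_sub, map_map, map_map]
    exact congrArg _ h
  | add x y hx hy =>
    simp only [map_add, hx, hy]
    abel

/-- The evaluation map `Hom^C(P, M) ⊗_S P → M`. -/
noncomputable def evalMap : BTensor P.endRing (P.homC M) P →+ M :=
  lift
    (AddMonoidHom.mk' (fun g => (g : P →ₗ[Aᵐᵒᵖ] M).toAddMonoidHom) (fun _ _ => rfl))
    (fun _ _ _ => rfl)

theorem galoisMap_subtype (x : BTensor P.endRing (P.homC M) P) :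
    P.galoisMap M (map (P.homC M).subtype LinearMap.id x) = M.coact (P.evalMap M x) := by
  induction x using BTensor.induction_on with
  | tmul g p => exact (mem_homC.1 g.2 p).symm
  | add x y hx hy => simp only [map_add, hx, hy]

theorem coact_injective : Function.Injective M.coact := fun m m' h => by
  rw [← M.coact_counit m, h, M.coact_counit]

variable {P}

/-- Flatness keeps `Hom^C(P, M) ⊗ P` the kernel of `defect ⊗ P`; `galoisMap_subtype` identifies its
embedding with evaluation followed by the injective coaction. -/
theorem IsGalois.evalMap_bijective (hP : P.IsGalois) (h : IsFlatModule P.endRing P) :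
    Function.Bijective (P.evalMap M) := by
  constructor
  · intro x y hxy
    apply h _ _ (P.homC M).subtype Subtype.val_injective
    apply (hP M).1
    rw [galoisMap_subtype, galoisMap_subtype, hxy]
  · intro m
    obtain ⟨x, hx⟩ := (hP M).2 (M.coact m)
    -- Coassociativity of `M` says that `ϱ^M(m)`, hence its Galois preimage `x`, is killed.
    obtain ⟨y, hy⟩ := h.exists_map_ker (P.defect M) x (by
      apply (hP _).1
      apply assoc_injective
      rw [assoc_galoisMap_defect, hx, M.coassoc, sub_self, map_zero, map_zero])
    refine ⟨y, coact_injective M ?_⟩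
    rw [← galoisMap_subtype, hy, hx]

theorem IsGalois.isSeparator (hP : P.IsGalois) (h : IsFlatModule P.endRing P) :
    IsSeparator P := by
  rw [isSeparator_def]
  intro X Y f g hfg
  refine Comod.Hom.ext (LinearMap.ext fun m => ?_)
  obtain ⟨x, rfl⟩ := (hP.evalMap_bijective X h).2 m
  induction x using BTensor.induction_on with
  | tmul k p =>
    have := hfg ⟨k, mem_homC.1 k.2⟩
    exact DFunLike.congr_fun (congrArg Comod.Hom.hom this) p
  | add x y hx hy => rw [map_add, map_add, map_add, hx, hy]

end Evaluation

/-! ### Cokernels of comodules; epimorphisms are surjective. -/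

section Cokernel

variable {M N : Comod A C} (f : M ⟶ N)

/-- The coaction on the cokernel of a comodule morphism. -/
noncomputable def cokernelCoact :
    (N ⧸ LinearMap.range f.hom) →ₗ[Aᵐᵒᵖ] BTensor A (N ⧸ LinearMap.range f.hom) C :=
  (LinearMap.range f.hom).liftQ (mapRight C (LinearMap.range f.hom).mkQ ∘ₗ N.coact) (by
    rintro _ ⟨m, rfl⟩
    rw [LinearMap.mem_ker, LinearMap.comp_apply, f.comm, mapRight_apply, map_map,
      LinearMap.range_mkQ_comp, map_zero_left]
    rfl)

/-- The cokernel of a comodule morphism. -/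
noncomputable def cokernel : Comod A C where
  carrier := N ⧸ LinearMap.range f.hom
  coact := cokernelCoact f
  coassoc m := by
    obtain ⟨n, rfl⟩ := Submodule.mkQ_surjective _ m
    have e : cokernelCoact f ∘ₗ (LinearMap.range f.hom).mkQ =
        mapRight C (LinearMap.range f.hom).mkQ ∘ₗ N.coact := Submodule.liftQ_mkQ _ _ _
    have h := assoc_map_mapRight (LinearMap.range f.hom).mkQ (map N.coact LinearMap.id (N.coact n))
    rw [N.coassoc, map_map, map_map, ← e] at h
    rw [← LinearMap.comp_apply (cokernelCoact f), e, LinearMap.comp_apply, mapRight_apply, map_map,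
      map_map]
    exact h
  coact_counit m := by
    obtain ⟨n, rfl⟩ := Submodule.mkQ_surjective _ m
    have h : ∀ x : BTensor A N A, rid A _ (map (LinearMap.range f.hom).mkQ LinearMap.id x) =
        (LinearMap.range f.hom).mkQ (rid A _ x) := fun x => by
      induction x using BTensor.induction_on with
      | tmul n a => rfl
      | add x y hx hy => simp only [map_add, hx, hy]
    have e := h (map LinearMap.id (Coring.counit (A := A) (C := C)).left (N.coact n))
    rw [N.coact_counit, map_map] at e
    change rid A _ (map LinearMap.id _ (map (LinearMap.range f.hom).mkQ LinearMap.id (N.coact n))) =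
      _
    rw [map_map]
    exact e

/-- The projection to the cokernel of a comodule morphism. -/
noncomputable def toCokernel : N ⟶ cokernel f :=
  ⟨(LinearMap.range f.hom).mkQ, fun _ => rfl⟩

/-- The zero morphism to the cokernel of a comodule morphism. -/
noncomputable def zeroToCokernel : N ⟶ cokernel f :=
  ⟨0, fun m => by
    rw [map_zero_left]
    exact map_zero _⟩

/-- The projection to the cokernel and the zero morphism agree after `f`, hence coincide. -/
theorem surjective_of_epi [Epi f] : Function.Surjective f.hom := fun n => by
  have h : f ≫ toCokernel f = f ≫ zeroToCokernel f :=
    Comod.Hom.ext (LinearMap.range_mkQ_comp f.hom)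
  have h' := (cancel_epi f).1 h
  exact (Submodule.Quotient.mk_eq_zero _).1
    (DFunLike.congr_fun (congrArg Comod.Hom.hom h') n)

end Cokernel

/-! ### Exactness of `Hom^C(P, -)` and projectivity of `P`. -/

/-- The map `Hom^C(P, f)`. -/
noncomputable def homCMap {M N : Comod A C} (f : M ⟶ N) :
    P.homC M →ₗ[(P.endRing)ᵐᵒᵖ] P.homC N :=
  (P.postcomp f.hom).restrict fun g hg => mem_homC.2 fun p => by
    change N.coact (f.hom (g p)) = map (f.hom ∘ₗ g) LinearMap.id (P.coact p)
    rw [f.comm, mem_homC.1 hg, map_map]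
    rfl

theorem evalMap_map_homCMap {M N : Comod A C} (f : M ⟶ N) (x : BTensor P.endRing (P.homC M) P) :
    P.evalMap N (map (P.homCMap f) LinearMap.id x) = f.hom (P.evalMap M x) := by
  induction x using BTensor.induction_on with
  | tmul g p => rfl
  | add x y hx hy => simp only [map_add, hx, hy]

variable {P}

/-- Evaluation identifies `Hom^C(P, f) ⊗_S P` with `f`, so the cokernel of `Hom^C(P, f)` vanishes
after tensoring with `P`, hence vanishes. -/
theorem IsGalois.homCMap_surjective (hP : P.IsGalois) (h : IsFaithfullyFlatModule P.endRing P)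
    {M N : Comod A C} (f : M ⟶ N) (hf : Function.Surjective f.hom) :
    Function.Surjective (P.homCMap f) := by
  have key : ∀ x : BTensor P.endRing (P.homC N ⧸ LinearMap.range (P.homCMap f)) P, x = 0 := by
    intro x
    obtain ⟨x, rfl⟩ := map_surjective (LinearMap.range (P.homCMap f)).mkQ_surjective
      (g := LinearMap.id) Function.surjective_id x
    obtain ⟨m, hm⟩ := hf (P.evalMap N x)
    obtain ⟨y, rfl⟩ := (hP.evalMap_bijective M h.1).2 m
    rw [← evalMap_map_homCMap] at hm
    rw [← (hP.evalMap_bijective N h.1).1 hm, map_map, LinearMap.range_mkQ_comp, map_zero_left]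
    rfl
  have := h.2 _ ⟨fun x y => (key x).trans (key y).symm⟩
  exact LinearMap.range_eq_top.1 (Submodule.Quotient.subsingleton_iff.1 this)

theorem IsGalois.projective_of_isFaithfullyFlat (hP : P.IsGalois)
    (h : IsFaithfullyFlatModule P.endRing P) : Projective P where
  factors {E X} f e _ := by
    obtain ⟨g, hg⟩ := hP.homCMap_surjective h e (surjective_of_epi e) ⟨f.hom, mem_homC.2 f.comm⟩
    exact ⟨⟨g, mem_homC.1 g.2⟩, Comod.Hom.ext (congrArg Subtype.val hg)⟩

end Comod

theorem mainTheorem2 {A C : Type u} [Ring A] [AddCommGroup C] [Module A C] [Module Aᵐᵒᵖ C]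
    [SMulCommClass A Aᵐᵒᵖ C] [Coring A C] (P : Comod A C) (hP : P.IsGalois) :
    (Module.Finite P.endRing P → Module.Finite A C) ∧
    (IsMittagLefflerModule P.endRing P → IsMittagLefflerModule A C) ∧
    (Module.FinitePresentation P.endRing P → Module.FinitePresentation A C) ∧
    (Module.Projective P.endRing P → Module.Projective A C) ∧
    (Module.Finite (Module.End Aᵐᵒᵖ P) P → IsLocallyProjectiveModule P.endRing P →
      IsLocallyProjectiveModule A C) ∧
    (IsFlatModule P.endRing P → IsFlatModule A C ∧ IsSeparator P) ∧
    (IsFaithfullyFlatModule P.endRing P →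
      IsFlatModule A C ∧ Projective P ∧ IsSeparator P) := by
  refine ⟨fun _ => hP.finite, hP.isMittagLeffler, fun _ => ?_, fun _ => hP.projective,
    fun _ => hP.isLocallyProjective, fun h => ⟨hP.isFlat h, hP.isSeparator h⟩,
    fun h => ⟨hP.isFlat h.1, hP.projective_of_isFaithfullyFlat h, hP.isSeparator h.1⟩⟩
  -- Finitely presented means finitely generated and Mittag-Leffler; both have been transferred.
  have := hP.finite
  exact (hP.isMittagLeffler .of_finitePresentation).finitePresentation
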